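/- Fix integers $0\le \mathcal O<P$. For each sample size $n$ let $X=X_n$ be a non-random $n\times P$ matrix, with $\operatorname{rank}(X)=P$ whenever $n>P$, such that $X'X/n$ converges to a nonsingular matrix $Q$ as $n\to\infty$. For $\theta\in\mathbb R^P$ and $\sigma>0$ let $P_{n,\theta,\sigma}$ be the law of $Y=X\theta+u$, where $u\sim N(0,\sigma^2I_n)$. For $0\le p\le P$ let $X[p]$ be the matrix of the first $p$ columns of $X$, and let $\tilde\theta(p)\in\mathbb R^P$ be the restricted least-squares estimator, whose first $p$ components are $(X[p]'X[p])^{-1}X[p]'Y$ and whose last $P-p$ components are $0$. Put $\hat\sigma^2=(n-P)^{-1}\|Y-X\tilde\theta(P)\|^2$ and, for $1\le p\le P$, $\xi_{n,p}=\big(\big[(X[p]'X[p]/n)^{-1}\big]_{p,p}\big)^{1/2}$, $$T_p=\frac{\sqrt n\,\tilde\theta_p(p)}{\hat\sigma\,\xi_{n,p}},\qquad T_p^*=\frac{\sqrt n\,\tilde\theta_p(p)}{\sigma\,\xi_{n,p}},$$ where $\tilde\theta_p(p)$ is the $p$-th component of $\tilde\theta(p)$, and $T_0=T_0^*=0$.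 Let the critical values $c_0,\dots,c_P\in\mathbb R$ not depend on $n$ and satisfy $c_{\mathcal O}=0$ and $0<c_p<\infty$ for $\mathcal O<p\le P$. Define $$\hat p=\max\{0\le p\le P:|T_p|\ge c_p\},\qquad \hat p^*=\max\{0\le p\le P:|T_p^*|\ge c_p\},$$ so that $\hat p,\hat p^*\in\{\mathcal O,\dots,P\}$, and let $\tilde\theta=\tilde\theta(\hat p)$ and $\tilde\theta^*=\tilde\theta(\hat p^*)$ be the post-model-selection estimator and its idealized (known-variance) version. Put $\pi_{n,\theta,\sigma}(p)=P_{n,\theta,\sigma}(\hat p=p)$ and $\pi^*_{n,\theta,\sigma}(p)=P_{n,\theta,\sigma}(\hat p^*=p)$. For finite measures $\mu,\nu$ write $\|\mu-\nu\|_{TV}=\sup_B|\mu(B)-\nu(B)|$, the supremum being over all measurable sets $B$. **Corollary A.1.** For each $n,\theta,\sigma$ let $\Psi_{n,\theta,\sigma}$ be a measurable function on $\mathbb R^P$, with values in any measurable space (which may depend on $n,\theta,\sigma$). Let $R_{n,\theta,\sigma}$ and $R^*_{n,\theta,\sigma}$ be the distributions of $\Psi_{n,\theta,\sigma}(\tilde\theta)$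 and of $\Psi_{n,\theta,\sigma}(\tilde\theta^*)$ under $P_{n,\theta,\sigma}$. Then $$\sup_{\theta\in\mathbb R^P,\ \sigma>0}\big\|R_{n,\theta,\sigma}-R^*_{n,\theta,\sigma}\big\|_{TV}\longrightarrow0\qquad(n\to\infty).$$ Moreover, let $R_{n,\theta,\sigma}(\cdot\,|\,p)$ and $R^*_{n,\theta,\sigma}(\cdot\,|\,p)$ be the distributions of $\Psi_{n,\theta,\sigma}(\tilde\theta)$ conditional on $\hat p=p$ and of $\Psi_{n,\theta,\sigma}(\tilde\theta^*)$ conditional on $\hat p^*=p$. Then, for each $p$ with $\mathcal O\le p\le P$, $$\sup_{\theta\in\mathbb R^P,\ \sigma>0}\big\|R_{n,\theta,\sigma}(\cdot\,|\,p)\,\pi_{n,\theta,\sigma}(p)-R^*_{n,\theta,\sigma}(\cdot\,|\,p)\,\pi^*_{n,\theta,\sigma}(p)\big\|_{TV}\longrightarrow0\qquad(n\to\infty).$$ -/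

import Mathlib

open MeasureTheory ProbabilityTheory Filter Topology
open scoped ENNReal Matrix

noncomputable section

namespace PostSelection

variable {n P : ℕ}

/-- The matrix `D[p]` of the first `p` columns of `D`. -/
def firstCols (D : Matrix (Fin n) (Fin P) ℝ) (p : ℕ) :
    Matrix (Fin n) {j : Fin P // j.val < p} ℝ :=
  D.submatrix id Subtype.val

/-- The least-squares estimator `θ̃(p)` under the restriction that all components after the
`p`-th vanish: the first `p` components are `(X[p]'X[p])⁻¹ X[p]'Y`, the other ones are zero. -/
def restrictedLS (X : Matrix (Fin n) (Fin P) ℝ) (p : ℕ) (Y : Fin n → ℝ) : Fin P → ℝ :=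
  fun j =>
    if h : j.val < p then
      (((firstCols X p)ᵀ * firstCols X p)⁻¹ *ᵥ ((firstCols X p)ᵀ *ᵥ Y)) ⟨j, h⟩
    else 0

/-- `ξ_{n,p}`, the square root of the `p`-th diagonal entry of `(X[p]'X[p]/n)⁻¹`, for `1 ≤ p ≤ P`.
The `p`-th component, counted from one, has index `p - 1` in `Fin P`. -/
def xi (X : Matrix (Fin n) (Fin P) ℝ) (p : ℕ) (hp : 0 < p ∧ p ≤ P) : ℝ :=
  Real.sqrt
    (((n : ℝ)⁻¹ • ((firstCols X p)ᵀ * firstCols X p))⁻¹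
      ⟨⟨p - 1, by omega⟩, by simp only; omega⟩ ⟨⟨p - 1, by omega⟩, by simp only; omega⟩)

/-- The estimator `σ̂` of the error standard deviation, from the overall model. -/
def sigmaHat (X : Matrix (Fin n) (Fin P) ℝ) (Y : Fin n → ℝ) : ℝ :=
  Real.sqrt (((n : ℝ) - (P : ℝ))⁻¹ * ∑ i, (Y i - (X *ᵥ restrictedLS X P Y) i) ^ 2)

/-- The test statistic `√n θ̃_p(p) / (s ξ_{n,p})` for `1 ≤ p ≤ P`, and `0` for `p = 0`; here `s` is
either the estimated or the true error standard deviation. -/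
def testStat (X : Matrix (Fin n) (Fin P) ℝ) (s : ℝ) (Y : Fin n → ℝ) (p : ℕ) : ℝ :=
  if hp : 0 < p ∧ p ≤ P then
    Real.sqrt n * restrictedLS X p Y ⟨p - 1, by omega⟩ / (s * xi X p hp)
  else 0

/-- The largest `p` in `{0, …, P}` with `|T_p| ≥ c_p`, where `T_p` is computed with the standard
deviation `s`. Such a `p` exists as soon as `c_p = 0` for some `p ≤ P`. -/
def selectWith (X : Matrix (Fin n) (Fin P) ℝ) (c : ℕ → ℝ) (s : ℝ) (Y : Fin n → ℝ) : ℕ :=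
  open scoped Classical in Nat.findGreatest (fun p => c p ≤ |testStat X s Y p|) P

/-- The model selector `p̂`, with estimated error variance. -/
def pHat (X : Matrix (Fin n) (Fin P) ℝ) (c : ℕ → ℝ) (Y : Fin n → ℝ) : ℕ :=
  selectWith X c (sigmaHat X Y) Y

/-- The idealized model selector `p̂*`, with known error variance `σ²`. -/
def pHatStar (X : Matrix (Fin n) (Fin P) ℝ) (c : ℕ → ℝ) (σ : ℝ) (Y : Fin n → ℝ) : ℕ :=
  selectWith X c σ Y

/-- The post-model-selection estimator `θ̃`: it equals `θ̃(p)` on the event `p̂ = p`. -/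
def thetaTilde (X : Matrix (Fin n) (Fin P) ℝ) (c : ℕ → ℝ) (Y : Fin n → ℝ) : Fin P → ℝ :=
  restrictedLS X (pHat X c Y) Y

/-- The idealized post-model-selection estimator `θ̃*`: it equals `θ̃(p)` on the event `p̂* = p`. -/
def thetaTildeStar (X : Matrix (Fin n) (Fin P) ℝ) (c : ℕ → ℝ) (σ : ℝ) (Y : Fin n → ℝ) :
    Fin P → ℝ :=
  restrictedLS X (pHatStar X c σ Y) Y

/-- `P_{n,θ,σ}`: the law of the sample `Y = Xθ + u` with `u ~ N(0, σ² I_n)`. -/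
def sampleLaw (X : Matrix (Fin n) (Fin P) ℝ) (θ : Fin P → ℝ) (σ : ℝ) : Measure (Fin n → ℝ) :=
  (Measure.pi fun _ : Fin n => gaussianReal 0 (σ ^ 2).toNNReal).map fun u => X *ᵥ θ + u

/-- For a selector `sel` and a statistic `f`, the conditional law of `f` given `sel = p`,
multiplied by the probability that `sel = p`. -/
def weightedCondLaw {Ω E : Type*} [MeasurableSpace Ω] [MeasurableSpace E] (μ : Measure Ω)
    (sel : Ω → ℕ) (f : Ω → E) (p : ℕ) : Measure E :=
  μ (sel ⁻¹' {p}) • (μ[|sel ⁻¹' {p}]).map f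

/-- Total variation distance `sup_B |μ(B) - ν(B)|` of two finite measures, which need not have the
same total mass, as an extended nonnegative number. -/
def tvDist {E : Type*} [MeasurableSpace E] (μ ν : Measure E) : ℝ≥0∞ :=
  ⨆ (B : Set E) (_ : MeasurableSet B), ENNReal.ofReal |μ.real B - ν.real B|

end PostSelection

end

namespace PostSelection

open scoped NNReal

variable {n P : ℕ}

/-! Both estimators are functions of the same sample and coincide where `p̂ = p̂*`, so both total
variation distances are at most the probability that the selectors differ. It remains to show that
this probability tends to zero uniformly in `θ` and `σ`.

Write `Y = Xθ + σz` with `z` standard normal. The ratio `σ̂/σ` depends on `z` alone (`sigmaHat_eq`)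
and tends to one in probability (`stdNormal_varRatio_le`). The statistics `T_p` and `T_p*` differ
only by this factor, so when it is within `ε` of one, the selectors can differ only if some `|T_p*|`
with `O < p ≤ P` lies within `ε c_p` of `c_p > 0`. Since `T_p*` is normal with variance one, its
density is bounded whatever its mean, and this event has probability `O(ε)` uniformly in the
parameters. Choosing `ε` small and then `n` large gives `tendsto_iSup_sampleLaw_pHat_ne`. -/

/-! ### Least squares algebra and the hat matrix -/

theorem firstCols_mulVec (X : Matrix (Fin n) (Fin P) ℝ) (p : ℕ) (v : {j : Fin P // j.val < p} → ℝ) :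
    firstCols X p *ᵥ v = X *ᵥ fun j => if h : j.val < p then v ⟨j, h⟩ else 0 := by
  ext i
  simp only [firstCols, Matrix.mulVec, dotProduct, Matrix.submatrix_apply, id]
  have h1 : ∑ j, (X i j * if h : j.val < p then v ⟨j, h⟩ else 0) =
      ∑ j ∈ Finset.univ.filter (fun j : Fin P => j.val < p),
        (X i j * if h : j.val < p then v ⟨j, h⟩ else 0) := by
    rw [Finset.sum_filter_of_ne]
    intro j _ hj
    by_contra h
    simp [h] at hj
  rw [h1, Finset.sum_subtype (p := fun j : Fin P => j.val < p) _ (by simp)]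
  refine Finset.sum_congr rfl fun j _ => ?_
  rw [dif_pos j.2]

theorem mulVec_restrictedLS (X : Matrix (Fin n) (Fin P) ℝ) (p : ℕ) (Y : Fin n → ℝ) :
    X *ᵥ restrictedLS X p Y = firstCols X p *ᵥ
      (((firstCols X p)ᵀ * firstCols X p)⁻¹ *ᵥ ((firstCols X p)ᵀ *ᵥ Y)) := by
  rw [firstCols_mulVec]; rfl

theorem mulVec_injective_of_rank_eq {X : Matrix (Fin n) (Fin P) ℝ} (hX : X.rank = P) :
    Function.Injective X.mulVec := by
  rw [Matrix.mulVec_injective_iff, linearIndependent_iff_card_eq_finrank_span,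
    Set.finrank, ← Matrix.rank_eq_finrank_span_cols, hX, Fintype.card_fin]

/-- Padding coefficients with zeros transfers injectivity from `X` to its leading columns. Hence
every inverse in the definitions is a true inverse, not the default value zero. -/
theorem posDef_gram {X : Matrix (Fin n) (Fin P) ℝ} (hX : X.rank = P) (p : ℕ) :
    ((firstCols X p)ᵀ * firstCols X p).PosDef := by
  have h : Function.Injective (firstCols X p).mulVec := by
    intro v w hvw
    rw [firstCols_mulVec, firstCols_mulVec] at hvw
    have := mulVec_injective_of_rank_eq hX hvw
    ext ⟨j, hj⟩
    simpa [hj] using congrFun this j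
  simpa [Matrix.conjTranspose_eq_transpose_of_trivial] using
    Matrix.PosDef.conjTranspose_mul_self (firstCols X p) h

/-- The orthogonal projection onto the column space of `X`, when `X` has full column rank. -/
noncomputable def hatMatrix (X : Matrix (Fin n) (Fin P) ℝ) : Matrix (Fin n) (Fin n) ℝ :=
  firstCols X P * ((firstCols X P)ᵀ * firstCols X P)⁻¹ * (firstCols X P)ᵀ

theorem hatMatrix_mulVec (X : Matrix (Fin n) (Fin P) ℝ) (Y : Fin n → ℝ) :
    hatMatrix X *ᵥ Y = X *ᵥ restrictedLS X P Y := by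
  rw [mulVec_restrictedLS, hatMatrix, Matrix.mulVec_mulVec, Matrix.mulVec_mulVec]

theorem hatMatrix_transpose (X : Matrix (Fin n) (Fin P) ℝ) : (hatMatrix X)ᵀ = hatMatrix X := by
  simp [hatMatrix, Matrix.transpose_mul, Matrix.transpose_nonsing_inv, Matrix.mul_assoc]

theorem hatMatrix_mul_firstCols {X : Matrix (Fin n) (Fin P) ℝ} (hX : X.rank = P) :
    hatMatrix X * firstCols X P = firstCols X P := by
  rw [hatMatrix, Matrix.mul_assoc, Matrix.mul_assoc,
    Matrix.nonsing_inv_mul _ (posDef_gram hX P).det_pos.ne'.isUnit, Matrix.mul_one]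

theorem hatMatrix_mul_self {X : Matrix (Fin n) (Fin P) ℝ} (hX : X.rank = P) :
    hatMatrix X * hatMatrix X = hatMatrix X := by
  nth_rw 2 [hatMatrix]
  rw [← Matrix.mul_assoc, ← Matrix.mul_assoc, hatMatrix_mul_firstCols hX, hatMatrix]

theorem hatMatrix_mulVec_mulVec {X : Matrix (Fin n) (Fin P) ℝ} (hX : X.rank = P)
    (θ : Fin P → ℝ) : hatMatrix X *ᵥ (X *ᵥ θ) = X *ᵥ θ := by
  have h : X *ᵥ θ = firstCols X P *ᵥ fun j => θ j := by
    rw [firstCols_mulVec]; simp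
  rw [h, Matrix.mulVec_mulVec, hatMatrix_mul_firstCols hX]

theorem hatMatrix_trace {X : Matrix (Fin n) (Fin P) ℝ} (hX : X.rank = P) :
    (hatMatrix X).trace = P := by
  rw [hatMatrix, Matrix.trace_mul_comm, ← Matrix.mul_assoc,
    Matrix.mul_nonsing_inv _ (posDef_gram hX P).det_pos.ne'.isUnit, Matrix.trace_one]
  simp

/-- For the symmetric idempotent `H`, the squared Frobenius norm is `tr (H H) = tr H`. This number
is the expectation of `‖Hz‖²` for standard normal `z`. -/
theorem sum_sq_hatMatrix {X : Matrix (Fin n) (Fin P) ℝ} (hX : X.rank = P) :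
    ∑ i, ∑ j, hatMatrix X i j ^ 2 = P := by
  have h (i j : Fin n) : hatMatrix X j i = hatMatrix X i j :=
    congrFun (congrFun (hatMatrix_transpose X) i) j
  have h2 : (hatMatrix X * hatMatrix X).trace = P := by
    rw [hatMatrix_mul_self hX, hatMatrix_trace hX]
  rw [← h2, Matrix.trace]
  simp only [Matrix.diag_apply, Matrix.mul_apply, sq]
  exact Finset.sum_congr rfl fun i _ => Finset.sum_congr rfl fun j _ => by rw [h i j]

theorem sum_sq_sub_hatMatrix_mulVec {X : Matrix (Fin n) (Fin P) ℝ} (hX : X.rank = P)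
    (z : Fin n → ℝ) :
    ∑ i, (z i - (hatMatrix X *ᵥ z) i) ^ 2 = ∑ i, z i ^ 2 - ∑ i, (hatMatrix X *ᵥ z) i ^ 2 := by
  have h : (hatMatrix X *ᵥ z) ⬝ᵥ (hatMatrix X *ᵥ z) = z ⬝ᵥ (hatMatrix X *ᵥ z) := by
    rw [Matrix.dotProduct_mulVec, Matrix.vecMul_mulVec, hatMatrix_transpose,
      hatMatrix_mul_self hX, ← hatMatrix_transpose X, Matrix.vecMul_transpose, dotProduct_comm,
      hatMatrix_transpose]
  simp only [dotProduct] at h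
  simp only [sub_sq, Finset.sum_add_distrib, Finset.sum_sub_distrib, mul_assoc, ← Finset.mul_sum,
    ← h]
  simp only [sq]; ring

/-- The residual map annihilates `Xθ`, so `σ̂/σ` is free of `θ` and `σ`; uniformity in the
parameters starts here. -/
theorem sigmaHat_eq {X : Matrix (Fin n) (Fin P) ℝ} (hX : X.rank = P) (θ : Fin P → ℝ) {σ : ℝ}
    (hσ : 0 ≤ σ) (z : Fin n → ℝ) :
    sigmaHat X (X *ᵥ θ + σ • z) =
      σ * Real.sqrt (((n : ℝ) - P)⁻¹ * (∑ i, z i ^ 2 - ∑ i, (hatMatrix X *ᵥ z) i ^ 2)) := by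
  rw [← sum_sq_sub_hatMatrix_mulVec hX, sigmaHat, ← hatMatrix_mulVec, Matrix.mulVec_add,
    hatMatrix_mulVec_mulVec hX, Matrix.mulVec_smul]
  rw [show ∀ x, σ * Real.sqrt x = Real.sqrt (σ ^ 2 * x) by
    intro x; rw [Real.sqrt_mul (sq_nonneg σ), Real.sqrt_sq hσ]]
  congr 1
  rw [mul_left_comm, Finset.mul_sum (a := σ ^ 2)]
  congr 1
  refine Finset.sum_congr rfl fun i _ => ?_
  simp only [Pi.add_apply, Pi.smul_apply, smul_eq_mul]; ring

/-- The coefficient row defining `θ̃_p(p)` has squared length equal to a diagonal entry of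
`(X[p]'X[p])⁻¹`, which is what `ξ_{n,p}` normalizes. Hence `T_p*` has variance one. -/
theorem exists_testStat_eq {X : Matrix (Fin n) (Fin P) ℝ} (hX : X.rank = P) (hn : 0 < n) {p : ℕ}
    (hp : 0 < p ∧ p ≤ P) :
    ∃ a : Fin n → ℝ, ∑ i, a i ^ 2 = 1 ∧ ∀ s Y, testStat X s Y p = (a ⬝ᵥ Y) / s := by
  set G := firstCols X p with hG
  have hpd : (Gᵀ * G).PosDef := posDef_gram hX p
  have hu : IsUnit (Gᵀ * G).det := hpd.det_pos.ne'.isUnit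
  have hn' : (0 : ℝ) < n := by exact_mod_cast hn
  let q : {j : Fin P // j.val < p} := ⟨⟨p - 1, by omega⟩, by simp only; omega⟩
  have hd : 0 < (Gᵀ * G)⁻¹ q q := hpd.inv.diag_pos
  have hxi : xi X p hp = Real.sqrt (n * (Gᵀ * G)⁻¹ q q) := by
    have := Matrix.inv_smul' (A := Gᵀ * G) (Units.mk0 (n : ℝ)⁻¹ (by positivity)) hu
    rw [xi]
    congr 1
    simpa [Units.smul_def] using congrFun (congrFun this q) q
  have hxi0 : 0 < xi X p hp := by rw [hxi]; positivity
  -- The diagonal entry at `q` of this identity is the squared length of row `q`.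
  have hsq : ((Gᵀ * G)⁻¹ * Gᵀ) * ((Gᵀ * G)⁻¹ * Gᵀ)ᵀ = (Gᵀ * G)⁻¹ := by
    rw [Matrix.transpose_mul, Matrix.transpose_transpose, Matrix.transpose_nonsing_inv,
      Matrix.transpose_mul, Matrix.transpose_transpose, Matrix.mul_assoc, ← Matrix.mul_assoc Gᵀ,
      Matrix.mul_nonsing_inv _ hu, Matrix.mul_one]
  refine ⟨(Real.sqrt n / xi X p hp) • ((Gᵀ * G)⁻¹ * Gᵀ) q, ?_, fun s Y => ?_⟩
  · have := congrFun (congrFun hsq q) q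
    simp only [Matrix.mul_apply (M := (Gᵀ * G)⁻¹ * Gᵀ), Matrix.transpose_apply, ← sq] at this
    simp only [Pi.smul_apply, smul_eq_mul, mul_pow, ← Finset.mul_sum]
    rw [this, hxi, div_pow, Real.sq_sqrt hn'.le, Real.sq_sqrt (by positivity)]
    field_simp
  · have hq : (⟨p - 1, by omega⟩ : Fin P).val < p := by simp only; omega
    rw [testStat, dif_pos hp, restrictedLS, dif_pos hq, Matrix.mulVec_mulVec, smul_dotProduct]
    change _ * ((((Gᵀ * G)⁻¹ * Gᵀ) q) ⬝ᵥ Y) / _ = _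
    rw [smul_eq_mul]
    field_simp

/-! ### Measurability of estimators and selectors -/

theorem measurable_mulVec {ι κ : Type*} [Fintype ι] (A : Matrix κ ι ℝ) :
    Measurable fun Y : ι → ℝ => A *ᵥ Y := by
  refine measurable_pi_lambda _ fun i => ?_
  simp only [Matrix.mulVec, dotProduct]
  fun_prop

theorem measurable_restrictedLS (X : Matrix (Fin n) (Fin P) ℝ) (p : ℕ) :
    Measurable (restrictedLS X p) := by
  refine measurable_pi_lambda _ fun j => ?_
  unfold restrictedLS
  split_ifs with h
  · exact (measurable_pi_apply (⟨j, h⟩ : {j : Fin P // j.val < p})).comp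
      ((measurable_mulVec (((firstCols X p)ᵀ * firstCols X p)⁻¹)).comp
        (measurable_mulVec (firstCols X p)ᵀ))
  · exact measurable_const

theorem measurable_sigmaHat (X : Matrix (Fin n) (Fin P) ℝ) : Measurable (sigmaHat X) := by
  unfold sigmaHat
  have := (measurable_mulVec X).comp (measurable_restrictedLS X P)
  have h (i : Fin n) : Measurable fun Y => (X *ᵥ restrictedLS X P Y) i :=
    (measurable_pi_apply i).comp this
  fun_prop

theorem measurable_selectWith (X : Matrix (Fin n) (Fin P) ℝ) (c : ℕ → ℝ) {s : (Fin n → ℝ) → ℝ}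
    (hs : Measurable s) : Measurable fun Y => selectWith X c (s Y) Y := by
  unfold selectWith
  refine measurable_findGreatest fun p _ => measurableSet_le measurable_const ?_
  refine Measurable.abs ?_
  unfold testStat
  split_ifs with h
  · have (j : Fin P) : Measurable fun Y => restrictedLS X p Y j :=
      (measurable_pi_apply j).comp (measurable_restrictedLS X p)
    fun_prop
  · exact measurable_const

theorem measurable_restrictedLS_comp (X : Matrix (Fin n) (Fin P) ℝ) {sel : (Fin n → ℝ) → ℕ}
    (h : Measurable sel) : Measurable fun Y => restrictedLS X (sel Y) Y := by
  have : Measurable fun q : (Fin n → ℝ) × ℕ => restrictedLS X q.2 q.1 :=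
    measurable_from_prod_countable_left fun p => measurable_restrictedLS X p
  exact this.comp (measurable_id.prodMk h)

/-! ### Gaussian vectors: linear forms, small intervals, moment inequalities -/

/-- The standard Gaussian law on `ℝⁿ`. -/
noncomputable abbrev stdNormal (n : ℕ) : Measure (Fin n → ℝ) :=
  Measure.pi fun _ : Fin n => gaussianReal 0 1

/-- Puts all parameters on one probability space. -/
theorem sampleLaw_eq_map_stdNormal (X : Matrix (Fin n) (Fin P) ℝ) (θ : Fin P → ℝ) (σ : ℝ) :
    sampleLaw X θ σ = (stdNormal n).map fun z => X *ᵥ θ + σ • z := by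
  have h : (Measure.pi fun _ : Fin n => gaussianReal 0 (σ ^ 2).toNNReal) =
      (stdNormal n).map fun z => σ • z := by
    have := Measure.pi_map_pi (μ := fun _ : Fin n => gaussianReal 0 1) (f := fun _ x => σ * x)
      (fun _ => by fun_prop)
    rw [show (fun z : Fin n → ℝ => σ • z) = fun z i => σ * z i from rfl, this]
    congr with i
    rw [gaussianReal_map_const_mul]
    congr 2
    · simp
    · ext; simp [sq_nonneg]
  rw [sampleLaw, h, Measure.map_map (by fun_prop) (by fun_prop)]
  rfl

instance isGaussian_stdNormal (n : ℕ) : IsGaussian (stdNormal n) := by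
  have h1 (i : Fin n) : HasGaussianLaw (fun z : Fin n → ℝ => z i) (stdNormal n) := by
    refine ⟨?_⟩
    have := (measurePreserving_eval (fun _ : Fin n => gaussianReal 0 1) i).map_eq
    rw [show (fun z : Fin n → ℝ => z i) = Function.eval i from rfl, this]
    infer_instance
  have h2 : iIndepFun (fun i (z : Fin n → ℝ) => z i) (stdNormal n) :=
    iIndepFun_pi (X := fun _ x => x) fun _ => aemeasurable_id
  simpa using (h2.hasGaussianLaw h1).isGaussian_map

theorem map_dotProduct_stdNormal (a : Fin n → ℝ) :
    (stdNormal n).map (fun z => a ⬝ᵥ z) = gaussianReal 0 (∑ i, a i ^ 2).toNNReal := by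
  let L : StrongDual ℝ (Fin n → ℝ) := ∑ i, a i • ContinuousLinearMap.proj i
  have hL : (fun z => a ⬝ᵥ z) = L := by
    ext z; simp [L, dotProduct]
  rw [hL, IsGaussian.map_eq_gaussianReal]
  congr 1
  · rw [← hL]
    simp only [dotProduct]
    rw [integral_finsetSum]
    · simp [integral_const_mul, integral_eval]
    · exact fun i _ => (integrable_eval IsGaussian.integrable_id).const_mul _
  · congr 1
    rw [← hL]
    have : (fun z => a ⬝ᵥ z) = ∑ i, fun z : Fin n → ℝ => a i * z i := by
      ext z; simp [dotProduct]
    rw [this, variance_sum_pi (X := fun i x => a i * x)]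
    · refine Finset.sum_congr rfl fun i _ => ?_
      rw [variance_const_mul, variance_fun_id_gaussianReal]; simp
    · exact fun i => (memLp_id_gaussianReal 2).const_mul _

theorem gaussianPDF_one_le_one (m x : ℝ) : gaussianPDF m 1 x ≤ 1 := by
  rw [gaussianPDF, ← ENNReal.ofReal_one]
  refine ENNReal.ofReal_le_ofReal ?_
  rw [gaussianPDFReal]
  refine mul_le_one₀ ?_ (Real.exp_nonneg _) ?_
  · refine inv_le_one_of_one_le₀ (Real.one_le_sqrt.2 ?_)
    have := Real.pi_gt_three
    simp; linarith
  · rw [Real.exp_le_one_iff]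
    simp only [NNReal.coe_one, neg_div, neg_nonpos]; positivity

/-- The density is at most `1/√(2π) < 1`, wherever the mean lies. -/
theorem gaussianReal_Icc_le (m a b : ℝ) :
    gaussianReal m 1 (Set.Icc a b) ≤ ENNReal.ofReal (b - a) := by
  rw [gaussianReal_apply m one_ne_zero, ← Real.volume_Icc]
  calc _ ≤ ∫⁻ _ in Set.Icc a b, 1 := lintegral_mono fun x => gaussianPDF_one_le_one m x
    _ = _ := by simp

/-- A unit linear form of a standard Gaussian vector, shifted by `m`, has its absolute value in
`[a, b]` with probability at most `2 (b - a)`. -/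
theorem stdNormal_abs_mem_Icc_le {v : Fin n → ℝ} (hv : ∑ i, v i ^ 2 = 1) (m a b : ℝ) :
    stdNormal n {z | |m + v ⬝ᵥ z| ∈ Set.Icc a b} ≤ 2 * ENNReal.ofReal (b - a) := by
  have hm : (stdNormal n).map (fun z => v ⬝ᵥ z) = gaussianReal 0 1 := by
    rw [map_dotProduct_stdNormal, hv]; simp
  have hmeas : Measurable fun z : Fin n → ℝ => v ⬝ᵥ z := by simp only [dotProduct]; fun_prop
  have hI (c d : ℝ) : stdNormal n {z | v ⬝ᵥ z ∈ Set.Icc c d} ≤ ENNReal.ofReal (d - c) := by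
    have := gaussianReal_Icc_le 0 c d
    rwa [← hm, Measure.map_apply hmeas measurableSet_Icc] at this
  calc _ ≤ stdNormal n ({z | v ⬝ᵥ z ∈ Set.Icc (a - m) (b - m)} ∪
        {z | v ⬝ᵥ z ∈ Set.Icc (-b - m) (-a - m)}) := by
        refine measure_mono fun z hz => ?_
        simp only [Set.mem_ofPred_eq, Set.mem_Icc, Set.mem_union] at hz ⊢
        rcases abs_cases (m + v ⬝ᵥ z) with h | h
        · left; constructor <;> linarith
        · right; constructor <;> linarith
    _ ≤ _ := measure_union_le _ _
    _ ≤ ENNReal.ofReal (b - m - (a - m)) + ENNReal.ofReal (-a - m - (-b - m)) :=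
        add_le_add (hI _ _) (hI _ _)
    _ = _ := by
        rw [two_mul]; congr 2 <;> ring

theorem integral_sq_gaussianReal : ∫ x, x ^ 2 ∂gaussianReal 0 1 = 1 := by
  have h := variance_eq_sub (memLp_id_gaussianReal (μ := 0) (v := 1) 2)
  rw [variance_id_gaussianReal] at h
  simpa using h.symm

theorem lintegral_sq_dotProduct (a : Fin n → ℝ) :
    ∫⁻ z, ENNReal.ofReal ((a ⬝ᵥ z) ^ 2) ∂stdNormal n = ENNReal.ofReal (∑ i, a i ^ 2) := by
  have hmeas : Measurable fun z : Fin n → ℝ => a ⬝ᵥ z := by simp only [dotProduct]; fun_prop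
  have h := map_dotProduct_stdNormal a
  set v := (∑ i, a i ^ 2).toNNReal with hv
  have h1 := variance_eq_sub (memLp_id_gaussianReal (μ := 0) (v := v) 2)
  rw [variance_id_gaussianReal] at h1
  have h2 : ∫ x, x ^ 2 ∂gaussianReal 0 v = v := by simpa using h1.symm
  have h3 : ∫⁻ x, ENNReal.ofReal (x ^ 2) ∂gaussianReal 0 v = ENNReal.ofReal (∑ i, a i ^ 2) := by
    rw [← ofReal_integral_eq_lintegral_ofReal, h2]
    · rw [hv, Real.coe_toNNReal _ (Finset.sum_nonneg fun i _ => sq_nonneg _)]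
    · exact (memLp_id_gaussianReal 2).integrable_sq
    · exact ae_of_all _ fun x => sq_nonneg x
  rw [← h3, ← h, lintegral_map (by fun_prop) hmeas]

/-- Markov's inequality for a Gaussian quadratic form. -/
theorem stdNormal_sum_sq_mulVec_ge_le (A : Matrix (Fin n) (Fin n) ℝ) {t : ℝ} (ht : 0 < t) :
    stdNormal n {z | t ≤ ∑ i, (A *ᵥ z) i ^ 2} ≤
      ENNReal.ofReal ((∑ i, ∑ j, A i j ^ 2) / t) := by
  have hm (i : Fin n) : Measurable fun z : Fin n → ℝ => (A *ᵥ z) i := by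
    simp only [Matrix.mulVec, dotProduct]; fun_prop
  have h1 : ∫⁻ z, ENNReal.ofReal (∑ i, (A *ᵥ z) i ^ 2) ∂stdNormal n =
      ENNReal.ofReal (∑ i, ∑ j, A i j ^ 2) := by
    simp_rw [ENNReal.ofReal_sum_of_nonneg (fun i _ => sq_nonneg _)]
    rw [lintegral_finsetSum _ (fun i _ => by have := hm i; fun_prop),
      ENNReal.ofReal_sum_of_nonneg (f := fun i => ∑ j, A i j ^ 2)
        (fun i _ => Finset.sum_nonneg fun j _ => sq_nonneg _)]
    exact Finset.sum_congr rfl fun i _ => lintegral_sq_dotProduct (A i)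
  rw [ENNReal.ofReal_div_of_pos ht, ← h1,
    show {z : Fin n → ℝ | t ≤ ∑ i, (A *ᵥ z) i ^ 2} =
      {z | ENNReal.ofReal t ≤ ENNReal.ofReal (∑ i, (A *ᵥ z) i ^ 2)} by
      ext z
      simp only [Set.mem_ofPred_eq]
      rw [ENNReal.ofReal_le_ofReal_iff (Finset.sum_nonneg fun i _ => sq_nonneg _)]]
  exact meas_ge_le_lintegral_div (by fun_prop) (by simpa using ht) ENNReal.ofReal_ne_top

/-- Chebyshev's inequality for the squared length of a standard Gaussian vector. -/
theorem stdNormal_abs_sum_sq_sub_ge_le (n : ℕ) {t : ℝ} (ht : 0 < t) :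
    stdNormal n {z | t ≤ |∑ i, z i ^ 2 - n|} ≤
      ENNReal.ofReal (n * Var[fun x => x ^ 2; gaussianReal 0 1] / t ^ 2) := by
  -- Finite fourth moments make `x²` square integrable, as Chebyshev requires.
  have hL : MemLp (fun x : ℝ => x ^ 2) 2 (gaussianReal 0 1) := by
    have := (memLp_id_gaussianReal (μ := 0) (v := 1) 4).norm_rpow_div 2
    have h4 : ((4 : ℝ≥0) : ℝ≥0∞) / 2 = 2 := by
      rw [ENNReal.div_eq_inv_mul, show ((4 : ℝ≥0) : ℝ≥0∞) = 2 * 2 by norm_num, ← mul_assoc,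
        ENNReal.inv_mul_cancel two_ne_zero ENNReal.ofNat_ne_top, one_mul]
    rw [h4] at this
    simpa using this
  have hLi (i : Fin n) : MemLp (fun z : Fin n → ℝ => z i ^ 2) 2 (stdNormal n) :=
    hL.comp_measurePreserving (measurePreserving_eval _ i)
  have hfun : (fun z : Fin n → ℝ => ∑ i, z i ^ 2) = ∑ i, fun z : Fin n → ℝ => z i ^ 2 := by
    ext z; simp
  have hvar : Var[fun z : Fin n → ℝ => ∑ i, z i ^ 2; stdNormal n] =
      n * Var[fun x => x ^ 2; gaussianReal 0 1] := by
    rw [hfun, variance_sum_pi (X := fun i x => x ^ 2) fun i => hL]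
    simp
  have hmean : ∫ z, ∑ i, z i ^ 2 ∂stdNormal n = n := by
    rw [integral_finsetSum _ fun i _ => (hLi i).integrable one_le_two]
    have (i : Fin n) : ∫ z, z i ^ 2 ∂stdNormal n = 1 := by
      rw [← integral_sq_gaussianReal,
        ← (measurePreserving_eval (fun _ : Fin n => gaussianReal 0 1) i).map_eq,
        integral_map (measurable_pi_apply i).aemeasurable (by fun_prop)]
    simp [this]
  have := meas_ge_le_variance_div_sq (memLp_finsetSum Finset.univ fun i _ => hLi i) ht
  rwa [hmean, hvar] at this

/-! ### Stability of the selector -/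

/-- Since `O` qualifies on both sides, indices below `O` never matter; no condition on their
critical values is needed. -/
theorem findGreatest_congr_of_lt {A B : ℕ → Prop} [DecidablePred A] [DecidablePred B] {O N : ℕ}
    (hO : O ≤ N) (hA : A O) (hB : B O) (h : ∀ p, O < p → p ≤ N → (A p ↔ B p)) :
    Nat.findGreatest A N = Nat.findGreatest B N := by
  have key {A B : ℕ → Prop} [DecidablePred A] [DecidablePred B] (hA : A O) (hB : B O)
      (h : ∀ p, O < p → p ≤ N → (A p ↔ B p)) :
      Nat.findGreatest A N ≤ Nat.findGreatest B N := by
    rcases (Nat.le_findGreatest hO hA).eq_or_lt with h1 | h1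
    · rw [← h1]; exact Nat.le_findGreatest hO hB
    · exact Nat.le_findGreatest (Nat.findGreatest_le N)
        ((h _ h1 (Nat.findGreatest_le N)).1 (Nat.findGreatest_spec hO hA))
  exact le_antisymm (key hA hB h) (key hB hA fun p h1 h2 => (h p h1 h2).symm)

theorem testStat_mul (X : Matrix (Fin n) (Fin P) ℝ) (s r : ℝ) (Y : Fin n → ℝ) (p : ℕ) :
    testStat X (s * r) Y p = testStat X s Y p / r := by
  unfold testStat
  split_ifs
  · rw [div_div]; congr 1; ring
  · simp

/-- Two selectors whose standard deviations have ratio `r` near one can only differ if a test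
statistic is near its critical value. -/
theorem exists_abs_testStat_mem_Icc_of_selectWith_ne {X : Matrix (Fin n) (Fin P) ℝ} {c : ℕ → ℝ}
    {O : ℕ} (hO : O ≤ P) (hcO : c O = 0) (hc : ∀ p, O < p → p ≤ P → 0 < c p) {σ r ε : ℝ}
    (hr : 0 < r) (hrε : |r - 1| ≤ ε) {Y : Fin n → ℝ}
    (h : selectWith X c (σ * r) Y ≠ selectWith X c σ Y) :
    ∃ p ∈ Finset.Ioc O P, |testStat X σ Y p| ∈ Set.Icc (c p * (1 - ε)) (c p * (1 + ε)) := by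
  by_contra! hcon
  refine h (findGreatest_congr_of_lt hO ?_ ?_ fun p h1 h2 => ?_)
  · rw [hcO]; exact abs_nonneg _
  · rw [hcO]; exact abs_nonneg _
  have h3 := hcon p (Finset.mem_Ioc.2 ⟨h1, h2⟩)
  have hcp := hc p h1 h2
  rw [abs_le] at hrε
  -- The two tests compare `|T_p*|` with `c_p r` and with `c_p`; both thresholds lie in the excluded
  -- interval.
  rw [testStat_mul, abs_div, abs_of_pos hr, le_div_iff₀ hr]
  rw [Set.mem_Icc, not_and_or, not_le, not_le] at h3
  constructor
  · intro h4
    rcases h3 with h3 | h3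
    · nlinarith
    · nlinarith
  · intro h4
    rcases h3 with h3 | h3
    · nlinarith
    · nlinarith

/-! ### Concentration of the variance ratio -/

/-- The ratio of estimated to true error variance, as a function of the standardized errors. -/
noncomputable def varRatio (X : Matrix (Fin n) (Fin P) ℝ) (z : Fin n → ℝ) : ℝ :=
  ((n : ℝ) - P)⁻¹ * (∑ i, z i ^ 2 - ∑ i, (hatMatrix X *ᵥ z) i ^ 2)

/-- The ratio minus one is `((‖z‖² - n) - ‖Hz‖² + P) / (n - P)`. If both random terms are below
`εn/4` in absolute value, the numerator is at most `εn/2 + P` in absolute value, and `hnε` says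
exactly that this is at most `ε(n - P)`. -/
theorem stdNormal_varRatio_le {X : Matrix (Fin n) (Fin P) ℝ} (hX : X.rank = P) (hn : P < n)
    {ε : ℝ} (hε : 0 < ε) (hnε : P * (1 + ε) ≤ ε * n / 2) :
    stdNormal n {z | ε < |varRatio X z - 1|} ≤
      ENNReal.ofReal (16 * Var[fun x => x ^ 2; gaussianReal 0 1] / ε ^ 2 * (n : ℝ)⁻¹) +
        ENNReal.ofReal (4 * P / ε * (n : ℝ)⁻¹) := by
  have hn0 : (0 : ℝ) < n := by exact_mod_cast (Nat.zero_le P).trans_lt hn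
  have hnP : (0 : ℝ) < n - P := by rw [sub_pos]; exact_mod_cast hn
  have ht : 0 < ε * n / 4 := by positivity
  have h1 := stdNormal_abs_sum_sq_sub_ge_le n ht
  have h2 := stdNormal_sum_sq_mulVec_ge_le (hatMatrix X) ht
  rw [sum_sq_hatMatrix hX] at h2
  calc _ ≤ stdNormal n ({z | ε * n / 4 ≤ |∑ i, z i ^ 2 - n|} ∪
        {z | ε * n / 4 ≤ ∑ i, (hatMatrix X *ᵥ z) i ^ 2}) := by
        refine measure_mono fun z hz => ?_
        simp only [Set.mem_ofPred_eq, Set.mem_union] at hz ⊢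
        by_contra! hcon
        obtain ⟨ha, hb⟩ := hcon
        refine hz.not_ge ?_
        have hq : 0 ≤ ∑ i, (hatMatrix X *ᵥ z) i ^ 2 := Finset.sum_nonneg fun i _ => sq_nonneg _
        have hP : (0 : ℝ) ≤ P := Nat.cast_nonneg P
        rw [varRatio, show ∀ x : ℝ, ((n : ℝ) - P)⁻¹ * x - 1 = (x - (n - P)) / (n - P) by
          intro x; field_simp, abs_div, abs_of_pos hnP, div_le_iff₀ hnP]
        rw [abs_lt] at ha
        rw [abs_le]
        constructor <;> nlinarith
    _ ≤ _ := measure_union_le _ _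
    _ ≤ _ := add_le_add h1 h2
    _ = _ := by
        congr 2
        · field_simp; norm_num
        · field_simp

/-! ### Probability that the selectors differ -/

theorem stdNormal_abs_testStat_mem_Icc_le {X : Matrix (Fin n) (Fin P) ℝ} (hX : X.rank = P)
    (hn : 0 < n) {p : ℕ} (hp : 0 < p ∧ p ≤ P) (θ : Fin P → ℝ) {σ : ℝ} (hσ : 0 < σ) (a b : ℝ) :
    stdNormal n {z | |testStat X σ (X *ᵥ θ + σ • z) p| ∈ Set.Icc a b} ≤
      2 * ENNReal.ofReal (b - a) := by
  obtain ⟨v, hv, h⟩ := exists_testStat_eq hX hn hp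
  have h1 (z : Fin n → ℝ) :
      testStat X σ (X *ᵥ θ + σ • z) p = (v ⬝ᵥ (X *ᵥ θ)) / σ + v ⬝ᵥ z := by
    rw [h, dotProduct_add, dotProduct_smul, smul_eq_mul]; field_simp
  simp only [h1]
  exact stdNormal_abs_mem_Icc_le hv _ _ _

theorem measurable_pHat (X : Matrix (Fin n) (Fin P) ℝ) (c : ℕ → ℝ) : Measurable (pHat X c) :=
  measurable_selectWith X c (measurable_sigmaHat X)

theorem measurable_pHatStar (X : Matrix (Fin n) (Fin P) ℝ) (c : ℕ → ℝ) (σ : ℝ) :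
    Measurable (pHatStar X c σ) :=
  measurable_selectWith X c measurable_const

theorem sampleLaw_pHat_ne_le {X : Matrix (Fin n) (Fin P) ℝ} (hX : X.rank = P) (hn : P < n)
    {c : ℕ → ℝ} {O : ℕ} (hO : O ≤ P) (hcO : c O = 0) (hc : ∀ p, O < p → p ≤ P → 0 < c p)
    (θ : Fin P → ℝ) {σ : ℝ} (hσ : 0 < σ) {ε : ℝ} (hε1 : ε < 1) :
    sampleLaw X θ σ {Y | pHat X c Y ≠ pHatStar X c σ Y} ≤
      stdNormal n {z | ε < |varRatio X z - 1|} +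
        ∑ p ∈ Finset.Ioc O P, 2 * ENNReal.ofReal (c p * 2 * ε) := by
  have hms : MeasurableSet {Y | pHat X c Y ≠ pHatStar X c σ Y} :=
    (measurableSet_eq_fun (measurable_pHat X c) (measurable_pHatStar X c σ)).compl
  rw [sampleLaw_eq_map_stdNormal, Measure.map_apply (by fun_prop) hms]
  calc _ ≤ stdNormal n ({z | ε < |varRatio X z - 1|} ∪ ⋃ p ∈ Finset.Ioc O P,
        {z | |testStat X σ (X *ᵥ θ + σ • z) p| ∈ Set.Icc (c p * (1 - ε)) (c p * (1 + ε))}) := by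
        refine measure_mono fun z hz => ?_
        rw [Set.mem_union, or_iff_not_imp_left]
        intro hz1
        simp only [Set.mem_ofPred_eq, not_lt] at hz1
        have hz1' := abs_le.1 hz1
        simp only [Set.mem_iUnion, Set.mem_ofPred_eq, exists_prop]
        have hpos : 0 < varRatio X z := by linarith
        refine exists_abs_testStat_mem_Icc_of_selectWith_ne hO hcO hc (Real.sqrt_pos.2 hpos)
          ?_ (Y := X *ᵥ θ + σ • z) ?_
        -- With `v` the ratio, `|√v - 1| ≤ |v - 1|` because `v - 1 = (√v - 1)(√v + 1)` and `√v + 1 ≥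
        -- 1`.
        · have h0 := Real.sqrt_nonneg (varRatio X z)
          have h1 := Real.sq_sqrt hpos.le
          refine le_trans ?_ hz1
          rw [show varRatio X z - 1 = (√(varRatio X z) - 1) * (√(varRatio X z) + 1) by
            linarith, abs_mul, abs_of_nonneg (a := √(varRatio X z) + 1) (by positivity)]
          exact le_mul_of_one_le_right (abs_nonneg _) (by linarith)
        · have : pHat X c (X *ᵥ θ + σ • z) ≠ pHatStar X c σ (X *ᵥ θ + σ • z) := hz
          rwa [pHat, sigmaHat_eq hX θ hσ.le] at this
    _ ≤ _ := measure_union_le _ _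
    _ ≤ _ := by
        gcongr
        refine (measure_biUnion_finset_le _ _).trans (Finset.sum_le_sum fun p hp => ?_)
        rw [Finset.mem_Ioc] at hp
        refine (stdNormal_abs_testStat_mem_Icc_le hX (by omega) (by omega) θ hσ _ _).trans_eq ?_
        congr 2; ring

theorem tendsto_iSup_sampleLaw_pHat_ne (X : (n : ℕ) → Matrix (Fin n) (Fin P) ℝ)
    (hrank : ∀ n : ℕ, P < n → (X n).rank = P) {c : ℕ → ℝ} {O : ℕ} (hO : O ≤ P) (hcO : c O = 0)
    (hc : ∀ p, O < p → p ≤ P → 0 < c p) :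
    Tendsto (fun n : ℕ => ⨆ (θ : Fin P → ℝ) (σ : ℝ) (_ : 0 < σ),
      sampleLaw (X n) θ σ {Y | pHat (X n) c Y ≠ pHatStar (X n) c σ Y}) atTop (𝓝 0) := by
  rw [ENNReal.tendsto_nhds_zero]
  intro η hη
  have hη2 : 0 < η / 2 := ENNReal.half_pos hη.ne'
  -- `ε` is fixed before `n`, so that the windows around all critical values together cost at most
  -- `η / 2`.
  obtain ⟨ε, hε, hε0, hε1⟩ : ∃ ε : ℝ,
      ∑ p ∈ Finset.Ioc O P, 2 * ENNReal.ofReal (c p * 2 * ε) ≤ η / 2 ∧ 0 < ε ∧ ε < 1 := by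
    have h1 : Tendsto (fun ε : ℝ => ∑ p ∈ Finset.Ioc O P, 2 * ENNReal.ofReal (c p * 2 * ε))
        (𝓝[>] 0) (𝓝 0) := by
      have h2 (p : ℕ) : Tendsto (fun ε : ℝ => 2 * ENNReal.ofReal (c p * 2 * ε)) (𝓝[>] 0) (𝓝 0) := by
        have h3 : Tendsto (fun ε : ℝ => ENNReal.ofReal (c p * 2 * ε)) (𝓝[>] 0)
            (𝓝 (ENNReal.ofReal (c p * 2 * 0))) :=
          (ENNReal.continuous_ofReal.comp (continuous_const_mul _)).continuousWithinAt
        have h4 := ENNReal.Tendsto.const_mul h3 (a := 2) (Or.inr ENNReal.ofNat_ne_top)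
        simpa using h4
      simpa using tendsto_finsetSum (Finset.Ioc O P) fun p _ => h2 p
    exact ((ENNReal.tendsto_nhds_zero.1 h1 _ hη2).and (Ioo_mem_nhdsGT one_pos)).exists
  have hlim (K : ℝ) : Tendsto (fun n : ℕ => ENNReal.ofReal (K * (n : ℝ)⁻¹)) atTop (𝓝 0) := by
    simpa using ENNReal.tendsto_ofReal (tendsto_inv_atTop_nhds_zero_nat.const_mul K)
  have hbad := (hlim (16 * Var[fun x => x ^ 2; gaussianReal 0 1] / ε ^ 2)).add (hlim (4 * P / ε))
  rw [add_zero] at hbad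
  have hlarge : ∀ᶠ n : ℕ in atTop, P * (1 + ε) ≤ ε * n / 2 := by
    filter_upwards [tendsto_natCast_atTop_atTop.eventually_ge_atTop (P * (1 + ε) * 2 / ε)]
      with n hn
    rw [div_le_iff₀ hε0] at hn
    linarith
  filter_upwards [ENNReal.tendsto_nhds_zero.1 hbad _ hη2, hlarge, eventually_gt_atTop P]
    with n h1 h2 h3
  refine iSup_le fun θ => iSup_le fun σ => iSup_le fun hσ => ?_
  refine (sampleLaw_pHat_ne_le (hrank n h3) h3 hO hcO hc θ hσ hε1).trans ?_
  refine (add_le_add ((stdNormal_varRatio_le (hrank n h3) h3 hε0 h2).trans h1) hε).trans_eq ?_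
  exact ENNReal.add_halves η

instance isProbabilityMeasure_sampleLaw (X : Matrix (Fin n) (Fin P) ℝ) (θ : Fin P → ℝ) (σ : ℝ) :
    IsProbabilityMeasure (sampleLaw X θ σ) := by
  rw [sampleLaw_eq_map_stdNormal]
  exact Measure.isProbabilityMeasure_map (by fun_prop)

/-! ### Total variation through coupling -/

section Coupling

variable {Ω E : Type*} [MeasurableSpace Ω] [MeasurableSpace E] {μ : Measure Ω} [IsFiniteMeasure μ]

theorem abs_measureReal_sub_le {A B D : Set Ω} (h : ∀ ω ∉ D, ω ∈ A ↔ ω ∈ B) :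
    |μ.real A - μ.real B| ≤ μ.real D := by
  have key {A B : Set Ω} (h : ∀ ω ∉ D, ω ∈ A ↔ ω ∈ B) : μ.real A ≤ μ.real B + μ.real D :=
    (measureReal_mono fun ω hω => by
      by_cases hD : ω ∈ D
      · exact Or.inr hD
      · exact Or.inl ((h ω hD).1 hω)).trans (measureReal_union_le B D)
  have h1 := key h
  have h2 := key fun ω hω => (h ω hω).symm
  rw [abs_le]; constructor <;> linarith

/-- The set maps `A` and `A'` cover both cases at once: preimages for the unconditional laws,
preimages cut with a selection event for the weighted conditional ones. -/
theorem tvDist_le_of_agree {ν ν' : Measure E} {A A' : Set E → Set Ω} {D : Set Ω}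
    (hν : ∀ B, MeasurableSet B → ν B = μ (A B)) (hν' : ∀ B, MeasurableSet B → ν' B = μ (A' B))
    (h : ∀ B, ∀ ω ∉ D, ω ∈ A B ↔ ω ∈ A' B) : tvDist ν ν' ≤ μ D := by
  refine iSup_le fun B => iSup_le fun hB => ?_
  rw [measureReal_def, measureReal_def, hν B hB, hν' B hB, ← ofReal_measureReal (s := D)]
  exact ENNReal.ofReal_le_ofReal (abs_measureReal_sub_le (h B))

/-- The weight cancels the normalization; if the selection event is null, both sides vanish. -/
theorem weightedCondLaw_apply {sel : Ω → ℕ} {f : Ω → E} (hsel : Measurable sel)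
    (hf : Measurable f) (p : ℕ) {B : Set E} (hB : MeasurableSet B) :
    weightedCondLaw μ sel f p B = μ (sel ⁻¹' {p} ∩ f ⁻¹' B) := by
  have hs : MeasurableSet (sel ⁻¹' {p}) := hsel (measurableSet_singleton p)
  rw [weightedCondLaw, Measure.smul_apply, Measure.map_apply hf hB, smul_eq_mul, mul_comm,
    cond_mul_eq_inter hs]

end Coupling

end PostSelection

theorem corollaryA1
    (P O : ℕ) (hO : O < P)
    -- one regressor matrix for each sample size
    (X : (n : ℕ) → Matrix (Fin n) (Fin P) ℝ)
    (hrank : ∀ n : ℕ, P < n → (X n).rank = P)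
    (Q : Matrix (Fin P) (Fin P) ℝ) (hQ : IsUnit Q.det)
    (hlim : Tendsto (fun n : ℕ => (n : ℝ)⁻¹ • ((X n)ᵀ * X n)) atTop (𝓝 Q))
    -- critical values
    (c : ℕ → ℝ) (hcO : c O = 0) (hc : ∀ p : ℕ, O < p → p ≤ P → 0 < c p)
    -- measurable maps on `ℝ^P`, with values in arbitrary measurable spaces
    (E : ℕ → (Fin P → ℝ) → ℝ → Type*)
    [∀ (n : ℕ) (θ : Fin P → ℝ) (σ : ℝ), MeasurableSpace (E n θ σ)]
    (Ψ : (n : ℕ) → (θ : Fin P → ℝ) → (σ : ℝ) → (Fin P → ℝ) → E n θ σ)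
    (hΨ : ∀ (n : ℕ) (θ : Fin P → ℝ) (σ : ℝ), Measurable (Ψ n θ σ)) :
    Tendsto
      (fun n : ℕ => ⨆ (θ : Fin P → ℝ) (σ : ℝ) (_ : 0 < σ),
        PostSelection.tvDist
          ((PostSelection.sampleLaw (X n) θ σ).map
            fun Y => Ψ n θ σ (PostSelection.thetaTilde (X n) c Y))
          ((PostSelection.sampleLaw (X n) θ σ).map
            fun Y => Ψ n θ σ (PostSelection.thetaTildeStar (X n) c σ Y)))
      atTop (𝓝 0) ∧
    ∀ p : ℕ, O ≤ p → p ≤ P →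
      Tendsto
        (fun n : ℕ => ⨆ (θ : Fin P → ℝ) (σ : ℝ) (_ : 0 < σ),
          PostSelection.tvDist
            (PostSelection.weightedCondLaw (PostSelection.sampleLaw (X n) θ σ)
              (PostSelection.pHat (X n) c)
              (fun Y => Ψ n θ σ (PostSelection.thetaTilde (X n) c Y)) p)
            (PostSelection.weightedCondLaw (PostSelection.sampleLaw (X n) θ σ)
              (PostSelection.pHatStar (X n) c σ)
              (fun Y => Ψ n θ σ (PostSelection.thetaTildeStar (X n) c σ Y)) p))
        atTop (𝓝 0) := by
  have hm := PostSelection.tendsto_iSup_sampleLaw_pHat_ne X hrank hO.le hcO hc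
  have hf (n : ℕ) (θ : Fin P → ℝ) (σ : ℝ) :
      Measurable fun Y => Ψ n θ σ (PostSelection.thetaTilde (X n) c Y) :=
    (hΨ n θ σ).comp
      (PostSelection.measurable_restrictedLS_comp (X n) (PostSelection.measurable_pHat (X n) c))
  have hf' (n : ℕ) (θ : Fin P → ℝ) (σ : ℝ) :
      Measurable fun Y => Ψ n θ σ (PostSelection.thetaTildeStar (X n) c σ Y) :=
    (hΨ n θ σ).comp (PostSelection.measurable_restrictedLS_comp (X n)
      (PostSelection.measurable_pHatStar (X n) c σ))
  refine ⟨tendsto_of_tendsto_of_tendsto_of_le_of_le tendsto_const_nhds hm (fun _ => zero_le)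
    fun n => iSup_mono fun θ => iSup_mono fun σ => iSup_mono fun _ => ?_, fun p _ _ =>
    tendsto_of_tendsto_of_tendsto_of_le_of_le tendsto_const_nhds hm (fun _ => zero_le)
    fun n => iSup_mono fun θ => iSup_mono fun σ => iSup_mono fun _ => ?_⟩
  · refine PostSelection.tvDist_le_of_agree (fun B hB => Measure.map_apply (hf n θ σ) hB)
      (fun B hB => Measure.map_apply (hf' n θ σ) hB) fun B Y hY => ?_
    have h : PostSelection.pHat (X n) c Y = PostSelection.pHatStar (X n) c σ Y := not_not.1 hY
    rw [Set.mem_preimage, Set.mem_preimage, PostSelection.thetaTilde, h,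
      PostSelection.thetaTildeStar]
  · refine PostSelection.tvDist_le_of_agree
      (fun B hB => PostSelection.weightedCondLaw_apply (PostSelection.measurable_pHat (X n) c)
        (hf n θ σ) p hB)
      (fun B hB => PostSelection.weightedCondLaw_apply
        (PostSelection.measurable_pHatStar (X n) c σ) (hf' n θ σ) p hB) fun B Y hY => ?_
    have h : PostSelection.pHat (X n) c Y = PostSelection.pHatStar (X n) c σ Y := not_not.1 hY
    rw [Set.mem_inter_iff, Set.mem_inter_iff, Set.mem_preimage, Set.mem_preimage,
      Set.mem_preimage, Set.mem_preimage, PostSelection.thetaTilde, h,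
      PostSelection.thetaTildeStar]
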